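/- Let $n\ge 2$ be an integer. For a polynomial $P\in\mathbb{C}[z]$ put $$E_P(0)=\{z\in\mathbb{C}:\ \ln|P(z)|=0\}=\{z\in\mathbb{C}:\ |P(z)|=1\},$$ and let $|E_P(0)|$ denote its length (one-dimensional Hausdorff measure). Let $P^*$ be an extremal polynomial of degree $n$ for the Erdős lemniscate-length problem, i.e. $P^*$ is a monic complex polynomial of degree $n$ such that $|E_Q(0)|\le |E_{P^*}(0)|$ for every monic complex polynomial $Q$ of degree $n$. Then the lemniscate $E_{P^*}(0)$ is singular, i.e. it contains at least one critical point of $P^*$: $$\{z\in\mathbb{C}:\ (P^*)'(z)=0\}\cap E_{P^*}(0)\neq\varnothing .$$ -/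

import Mathlib

open MeasureTheory

/-- The `t`-lemniscate `E_f(t) = {z : ln |f(z)| = t}` of a function `f : ℂ → ℂ`. Zeros of `f`
are excluded explicitly, since there `ln |f|` is `-∞`, whereas `Real.log 0 = 0`. -/
def lemniscate (f : ℂ → ℂ) (t : ℝ) : Set ℂ :=
  {z | f z ≠ 0 ∧ Real.log ‖f z‖ = t}

/-- The length `|E_f(t)|` of the `t`-lemniscate: its one-dimensional Hausdorff measure in the
Euclidean plane. -/
noncomputable def lemniscateLength (f : ℂ → ℂ) (t : ℝ) : ENNReal :=
  Measure.hausdorffMeasure 1 (lemniscate f t)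

/-- `P` is an extremal polynomial of degree `n`: it maximizes the length of `E_P(0)` among all
monic complex polynomials of degree `n`. -/
def IsExtremalPolynomial (n : ℕ) (P : Polynomial ℂ) : Prop :=
  P.Monic ∧ P.natDegree = n ∧
    ∀ Q : Polynomial ℂ, Q.Monic → Q.natDegree = n →
      lemniscateLength (fun z => Q.eval z) 0 ≤ lemniscateLength (fun z => P.eval z) 0

open Metric Set Filter Topology

namespace Lemniscate

/-! Suppose `E = {|P| = 1}` carries no critical point. For small `l` the solution `φ (z, l)` of `P w
= P z + l` near `z` maps `E` injectively into the lemniscate of the competitor `P - l`, stretching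
length at `z` by `|P'(z) / P'(φ (z, l))|`. This is the modulus of a holomorphic function of `l` with
value 1 at `l = 0`, so its mean over a small circle is at least 1. Equality would make `P'` constant
on infinitely many points, impossible in degree at least 2. Hence the mean length of the competitors
exceeds `|E|`, against extremality.

No area formula is needed: `exists_open_expansion` bounds the stretching below locally, and
`exists_average_length_gt` adds up the pieces by compactness. The divided difference `q` turns every
estimate into an exact identity. -/

/-- The divided difference of a polynomial is a continuous function of two variables. -/
theorem exists_dividedDifference (P : Polynomial ℂ) :
    ∃ q : ℂ × ℂ → ℂ, Continuous q ∧ (∀ x y, P.eval x - P.eval y = q (x, y) * (x - y)) ∧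
      ∀ x, q (x, x) = P.derivative.eval x := by
  induction P using Polynomial.induction_on' with
  | add p r hp hr =>
    obtain ⟨a, ha, ha', ha''⟩ := hp
    obtain ⟨b, hb, hb', hb''⟩ := hr
    refine ⟨fun x => a x + b x, ha.add hb, fun x y => ?_, fun x => ?_⟩
    · rw [add_mul, ← ha', ← hb', Polynomial.eval_add, Polynomial.eval_add]
      ring
    · simp [ha'', hb'']
  | monomial n c =>
    refine ⟨fun x => c * ∑ i ∈ Finset.range n, x.1 ^ i * x.2 ^ (n - 1 - i), by fun_prop,
      fun x y => ?_, fun x => ?_⟩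
    · rw [mul_assoc, geom_sum₂_mul]
      simp [mul_sub]
    · simp only [geom_sum₂_self, Polynomial.derivative_monomial, Polynomial.eval_monomial]
      ring

/-! ### Length under expanding maps, and the unit circle -/

/-- A map expanding distances by at least `c` expands the length by at least `c`. -/
theorem ofReal_mul_hausdorffMeasure_le {F : ℂ → ℂ} {s : Set ℂ} {c : ℝ}
    (h : ∀ x ∈ s, ∀ y ∈ s, c * dist x y ≤ dist (F x) (F y)) :
    ENNReal.ofReal c * μH[1] s ≤ μH[1] (F '' s) := by
  rcases le_or_gt c 0 with hc | hc
  · simp [ENNReal.ofReal_of_nonpos hc]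
  have hanti : AntilipschitzWith (Real.toNNReal c⁻¹) (fun x : s => F x) := by
    refine AntilipschitzWith.of_le_mul_dist fun x y => ?_
    rw [Real.coe_toNNReal _ (inv_nonneg.2 hc.le), inv_mul_eq_div, le_div_iff₀' hc]
    exact h x x.2 y y.2
  have h1 := hanti.le_hausdorffMeasure_image zero_le_one univ
  have h2 := isometry_subtype_coe.hausdorffMeasure_image (s := (univ : Set s))
    (Or.inl zero_le_one)
  have h3 : (fun x : s => F x) '' univ = F '' s := by
    ext; simp
  rw [h3, ← h2, image_univ, Subtype.range_coe, ENNReal.rpow_one] at h1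
  calc ENNReal.ofReal c * μH[1] s
      ≤ ENNReal.ofReal c * (ENNReal.ofReal c⁻¹ * μH[1] (F '' s)) := by gcongr; exact h1
    _ = μH[1] (F '' s) := by
      rw [← mul_assoc, ← ENNReal.ofReal_mul hc.le, mul_inv_cancel₀ hc.ne', ENNReal.ofReal_one,
        one_mul]

theorem hausdorffMeasure_sphere_lt_top : μH[1] (sphere (0 : ℂ) 1) < ⊤ := by
  have h1 : sphere (0 : ℂ) 1 ⊆ circleMap 0 1 '' Ioc 0 (2 * Real.pi) := by
    rw [image_circleMap_Ioc]; simp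
  have h2 := (lipschitzWith_circleMap (0 : ℂ) 1).hausdorffMeasure_image_le (zero_le_one' ℝ)
    (Ioc 0 (2 * Real.pi))
  refine (measure_mono h1).trans_lt (h2.trans_lt ?_)
  rw [hausdorffMeasure_real, Real.volume_Ioc]
  exact ENNReal.mul_lt_top (by simp) ENNReal.ofReal_lt_top

/-- The real part is 1-Lipschitz and maps the circle onto `[-1, 1]`. -/
theorem hausdorffMeasure_sphere_pos : 0 < μH[1] (sphere (0 : ℂ) 1) := by
  have hre : LipschitzWith 1 Complex.re :=
    LipschitzWith.of_dist_le_mul fun x y => by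
      simpa [Real.dist_eq, dist_eq_norm] using Complex.abs_re_le_norm (x - y)
  have h := hre.hausdorffMeasure_image_le (zero_le_one' ℝ) (sphere (0 : ℂ) 1)
  have hsub : Icc (-1 : ℝ) 1 ⊆ Complex.re '' sphere (0 : ℂ) 1 := by
    intro x hx
    refine ⟨Complex.exp (Real.arccos x * Complex.I), by simp [Complex.norm_exp], ?_⟩
    rw [Complex.exp_ofReal_mul_I_re, Real.cos_arccos hx.1 hx.2]
  have h2 : (0 : ENNReal) < μH[1] (Icc (-1 : ℝ) 1) := by
    rw [hausdorffMeasure_real, Real.volume_Icc]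
    norm_num
  have := h2.trans_le ((measure_mono hsub).trans h)
  simpa using this

/-! ### Equality in the mean value inequality -/

/-- A nonnegative continuous function with nonpositive circle average vanishes on the circle. -/
theorem eq_zero_of_circleAverage_nonpos {u : ℂ → ℝ} {r : ℝ} (hr : 0 < r)
    (hu : ContinuousOn u (sphere 0 r)) (h0 : ∀ x ∈ sphere 0 r, 0 ≤ u x)
    (havg : Real.circleAverage u 0 r ≤ 0) : ∀ x ∈ sphere 0 r, u x = 0 := by
  have hcont : Continuous fun θ => u (circleMap 0 r θ) :=
    hu.comp_continuous (continuous_circleMap 0 r) fun θ => circleMap_mem_sphere 0 hr.le θ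
  have hnn : ∀ θ, 0 ≤ u (circleMap 0 r θ) := fun θ => h0 _ (circleMap_mem_sphere 0 hr.le θ)
  by_contra! hne
  obtain ⟨x, hx, hux⟩ := hne
  have hx' : x ∈ circleMap 0 r '' Ioc 0 (2 * Real.pi) := by
    rw [image_circleMap_Ioc, abs_of_pos hr]; exact hx
  obtain ⟨θ, hθ, rfl⟩ := hx'
  have hpos : 0 < ∫ t in (0 : ℝ)..2 * Real.pi, u (circleMap 0 r t) :=
    intervalIntegral.integral_pos Real.two_pi_pos hcont.continuousOn (fun t _ => hnn t)
      ⟨θ, Ioc_subset_Icc_self hθ, (hnn θ).lt_of_ne' hux⟩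
  rw [Real.circleAverage_def, smul_eq_mul] at havg
  have : 0 < (2 * Real.pi)⁻¹ := inv_pos.2 Real.two_pi_pos
  nlinarith [mul_pos this hpos]

/-- The equality case in the mean value inequality for `|h|`, `h` holomorphic. -/
theorem eq_one_of_circleAverage_norm_le {h : ℂ → ℂ} {r : ℝ} (hr : 0 < r)
    (hd : DiffContOnCl ℂ h (ball 0 r)) (h0 : h 0 = 1)
    (havg : Real.circleAverage (fun x => ‖h x‖) 0 r ≤ 1) : ∀ x ∈ sphere 0 r, h x = 1 := by
  have hcont : ContinuousOn h (sphere 0 r) :=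
    hd.continuousOn.mono (by rw [closure_ball _ hr.ne']; exact sphere_subset_closedBall)
  have hint : ∀ {u : ℂ → ℝ}, ContinuousOn u (sphere 0 r) → CircleIntegrable u 0 r :=
    fun hu => hu.circleIntegrable hr.le
  have hre : ∀ g : ℂ → ℂ, DiffContOnCl ℂ g (ball 0 r) → ContinuousOn g (sphere 0 r) →
      Real.circleAverage (fun x => (g x).re) 0 r = (g 0).re := by
    intro g hg hgc
    have h1 := Complex.reCLM.circleAverage_comp_comm (hgc.circleIntegrable hr.le)
    have h2 : Real.circleAverage g 0 r = g 0 :=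
      DiffContOnCl.circleAverage (by rwa [abs_of_pos hr])
    rw [h2] at h1
    exact h1
  have hre1 := hre h hd hcont
  have hreal : ∀ x ∈ sphere 0 r, ‖h x‖ - (h x).re = 0 := by
    refine eq_zero_of_circleAverage_nonpos hr (by fun_prop)
      (fun x _ => sub_nonneg.2 (Complex.re_le_norm _)) ?_
    rw [Real.circleAverage_fun_sub (hint (by fun_prop)) (hint (by fun_prop)), hre1, h0]
    simpa using havg
  have him : ∀ x ∈ sphere 0 r, (h x).im = 0 := by
    intro x hx
    have h1 := Complex.sq_norm (h x)
    rw [sub_eq_zero.1 (hreal x hx), Complex.normSq_apply] at h1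
    nlinarith
  -- Since `h` is real on the circle, `Re (h - 1)²` is a nonnegative square there, while its mean is
  -- its value 0 at the centre.
  have hsq : DiffContOnCl ℂ (fun x => (h x - 1) ^ 2) (ball 0 r) := by
    have h1 := hd.sub_const 1
    simpa [pow_two] using h1.smul h1
  have hre2 := hre _ hsq (by fun_prop)
  have hval : ∀ x ∈ sphere 0 r, ((h x - 1) ^ 2).re = ((h x).re - 1) ^ 2 := by
    intro x hx
    simp [pow_two, Complex.mul_re, him x hx]
  have hzero := eq_zero_of_circleAverage_nonpos (u := fun x => ((h x - 1) ^ 2).re) hr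
    (by fun_prop) (fun x hx => by simp only [hval x hx]; positivity) (by rw [hre2, h0]; simp)
  intro x hx
  have h1 := hzero x hx
  simp only [hval x hx] at h1
  have h2 : (h x).re - 1 = 0 := pow_eq_zero_iff two_ne_zero |>.1 h1
  exact Complex.ext (by simp; linarith) (by simp [him x hx])

/-! ### The continuation `φ` and its regularity -/

/-- If a monic polynomial takes a small value at `z`, it has a root near `z`. -/
theorem exists_root_near {P : Polynomial ℂ} (hP : P.Monic) {z : ℂ} {ρ : ℝ}
    (hρ : 0 < ρ) (h : ‖P.eval z‖ < ρ ^ P.natDegree) : ∃ w, P.eval w = 0 ∧ dist w z < ρ := by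
  by_contra! hw
  have hs := IsAlgClosed.splits P
  have hev : P.eval z = (P.roots.map fun a => z - a).prod := by
    conv_lhs => rw [hs.eq_prod_roots_of_monic hP]
    rw [Polynomial.eval_multiset_prod, Multiset.map_map]
    simp
  have hcard : P.natDegree = P.roots.card := hs.natDegree_eq_card_roots
  rw [hev, hcard] at h
  refine absurd h (not_lt.2 ?_)
  have hroots : ∀ a ∈ P.roots, ρ ≤ ‖z - a‖ := fun a ha => by
    have := hw a (Polynomial.isRoot_of_mem_roots ha)
    rwa [dist_comm, dist_eq_norm] at this
  clear h hcard hev hs hw hP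
  revert hroots
  generalize P.roots = s
  intro hroots
  induction s using Multiset.induction_on with
  | empty => simp
  | cons a s ih =>
    rw [Multiset.card_cons, Multiset.map_cons, Multiset.prod_cons, norm_mul, pow_succ']
    have h1 := ih fun b hb => hroots b (Multiset.mem_cons_of_mem hb)
    have h2 := hroots a (Multiset.mem_cons_self a s)
    gcongr

/-- Analytic continuation of the identity along `λ`: near a compact set without critical points,
the equation `P w = P z + λ` has a continuous solution `w = φ (z, λ)` with `φ (z, 0) = z`. -/
theorem exists_continuation {P : Polynomial ℂ} (hP : P.Monic) (hn : P.natDegree ≠ 0)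
    {q : ℂ × ℂ → ℂ} (hq : Continuous q)
    (hPq : ∀ x y, P.eval x - P.eval y = q (x, y) * (x - y)) {E : Set ℂ} (hE : IsCompact E)
    (hEq : ∀ z ∈ E, q (z, z) ≠ 0) :
    ∃ δ > 0, ∃ φ : ℂ × ℂ → ℂ, (∀ z ∈ E, ∀ l ∈ ball (0 : ℂ) δ, P.eval (φ (z, l)) = P.eval z + l) ∧
      (∀ z ∈ E, ∀ l ∈ ball (0 : ℂ) δ, q (φ (z, l), φ (z, l)) ≠ 0) ∧
      (∀ z ∈ E, φ (z, 0) = z) ∧ ContinuousOn φ (E ×ˢ ball 0 δ) ∧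
      ∀ l ∈ ball (0 : ℂ) δ, InjOn (fun z => φ (z, l)) E := by
  obtain ⟨m, hm, hmE⟩ : ∃ m, 0 < m ∧ ∀ z ∈ E, m ≤ ‖q (z, z)‖ :=
    hE.exists_forall_le' (by fun_prop) fun z hz => norm_pos_iff.2 (hEq z hz)
  obtain ⟨η, hη, hηq⟩ : ∃ η > 0, ∀ z ∈ E, ∀ x y, dist x z < η → dist y z < η →
      m / 2 < ‖q (x, y)‖ := by
    have hK : IsCompact ((fun z : ℂ => (z, z)) '' E) := hE.image (by fun_prop)
    have hV : IsOpen {p : ℂ × ℂ | m / 2 < ‖q p‖} := isOpen_lt (by fun_prop) (by fun_prop)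
    obtain ⟨η, hη, hsub⟩ := hK.exists_thickening_subset_open hV (by
      rintro _ ⟨z, hz, rfl⟩
      exact (half_lt_self hm).trans_le (hmE z hz))
    refine ⟨η, hη, fun z hz x y hx hy => hsub ?_⟩
    exact mem_thickening_iff.2 ⟨(z, z), ⟨z, hz, rfl⟩, by simpa [Prod.dist_eq] using ⟨hx, hy⟩⟩
  -- Any root within `η / 3` will do: two such errors stay below `η`, where `‖q‖ > m / 2` makes
  -- roots unique. Continuity and injectivity of the chosen `φ` follow from this.
  have hex : ∀ p : ℂ × ℂ, ∃ w, p.2 ∈ ball (0 : ℂ) ((η / 3) ^ P.natDegree) →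
      P.eval w = P.eval p.1 + p.2 ∧ dist w p.1 < η / 3 := by
    rintro ⟨z, l⟩
    by_cases hl : l ∈ ball (0 : ℂ) ((η / 3) ^ P.natDegree)
    · have hdeg : (P - Polynomial.C (P.eval z + l)).natDegree = P.natDegree :=
        Polynomial.natDegree_sub_C
      have hmon : (P - Polynomial.C (P.eval z + l)).Monic :=
        hP.sub_of_left (Polynomial.degree_C_le.trans_lt
          (Polynomial.natDegree_pos_iff_degree_pos.1 (Nat.pos_of_ne_zero hn)))
      obtain ⟨w, hw, hwz⟩ := exists_root_near hmon (z := z) (ρ := η / 3)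
        (by positivity) (by rw [hdeg]; simpa using hl)
      exact ⟨w, fun _ => ⟨by simpa [sub_eq_zero] using hw, hwz⟩⟩
    · exact ⟨0, fun h => absurd h hl⟩
  choose φ hφ using hex
  refine ⟨(η / 3) ^ P.natDegree, by positivity, φ, fun z _ l hl => (hφ (z, l) hl).1,
    fun z hz l hl => ?_, fun z hz => ?_, ?_, fun l hl x hx y hy hxy => ?_⟩
  · have h1 := (hφ (z, l) hl).2
    have h2 := hηq z hz (φ (z, l)) (φ (z, l)) (by dsimp only at h1; linarith)
      (by dsimp only at h1; linarith)
    exact norm_pos_iff.1 ((half_pos hm).trans h2)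
  · obtain ⟨h1, h2⟩ := hφ (z, 0) (mem_ball_self (by positivity))
    dsimp only at h1 h2
    have h3 := hPq (φ (z, 0)) z
    rw [h1, add_zero, sub_self, eq_comm, mul_eq_zero] at h3
    have h4 := hηq z hz (φ (z, 0)) z (by linarith) (by simpa using hη)
    exact sub_eq_zero.1 (h3.resolve_left (norm_pos_iff.1 ((half_pos hm).trans h4)))
  · rintro ⟨z, l⟩ ⟨hz, hl⟩
    dsimp only at hz hl
    rw [ContinuousWithinAt, tendsto_iff_dist_tendsto_zero]
    have hev : Continuous fun p : ℂ × ℂ => P.eval p.1 + p.2 := by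
      have := P.continuous
      fun_prop
    have hlim : Tendsto (fun p : ℂ × ℂ => dist (P.eval p.1 + p.2) (P.eval z + l) / (m / 2))
        (𝓝[E ×ˢ ball 0 ((η / 3) ^ P.natDegree)] (z, l)) (𝓝 0) := by
      have h1 : Continuous fun p : ℂ × ℂ =>
          dist (P.eval p.1 + p.2) (P.eval z + l) / (m / 2) := by fun_prop
      have h2 := (h1.tendsto (z, l)).mono_left (nhdsWithin_le_nhds
        (s := E ×ˢ ball 0 ((η / 3) ^ P.natDegree)))
      simpa using h2
    refine squeeze_zero' (Eventually.of_forall fun _ => dist_nonneg) ?_ hlim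
    have hnear : ∀ᶠ p in 𝓝[E ×ˢ ball 0 ((η / 3) ^ P.natDegree)] ((z, l) : ℂ × ℂ),
        dist p.1 z < η / 3 := by
      refine nhdsWithin_le_nhds ?_
      exact (continuous_fst.dist continuous_const).continuousAt.eventually_lt continuousAt_const
        (by simpa using hη)
    filter_upwards [hnear, self_mem_nhdsWithin] with p hp hpE
    obtain ⟨h1, h2⟩ := hφ p hpE.2
    obtain ⟨h3, h4⟩ := hφ (z, l) hl
    dsimp only at h3 h4
    have h5 := hηq z hz (φ p) (φ (z, l)) (by linarith [dist_triangle (φ p) p.1 z]) (by linarith)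
    have h6 := hPq (φ p) (φ (z, l))
    rw [le_div_iff₀ (half_pos hm), ← h1, ← h3, dist_eq_norm (P.eval _), h6, norm_mul,
      ← dist_eq_norm, mul_comm]
    gcongr
  · obtain ⟨h1, h2⟩ := hφ (x, l) hl
    obtain ⟨h3, h4⟩ := hφ (y, l) hl
    dsimp only at h1 h2 h3 h4 hxy
    rw [hxy] at h1 h2
    have h5 := hηq x hx x y (by simpa using hη)
      (by rw [dist_comm] at h4; linarith [dist_triangle y (φ (y, l)) x])
    have h6 := hPq x y
    rw [add_right_cancel (h1.symm.trans h3), sub_self, eq_comm, mul_eq_zero] at h6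
    exact sub_eq_zero.1 (h6.resolve_left (norm_pos_iff.1 ((half_pos hm).trans h5)))

/-- A continuous solution `φ` of `P (φ l) = a + l` is holomorphic off the critical points. -/
theorem differentiableOn_of_eval_eq {P : Polynomial ℂ} {q : ℂ × ℂ → ℂ} (hq : Continuous q)
    (hPq : ∀ x y, P.eval x - P.eval y = q (x, y) * (x - y)) {φ : ℂ → ℂ} {U : Set ℂ}
    (hU : IsOpen U) (hφ : ContinuousOn φ U) {a : ℂ} (hP : ∀ l ∈ U, P.eval (φ l) = a + l)
    (hne : ∀ l ∈ U, q (φ l, φ l) ≠ 0) : DifferentiableOn ℂ φ U := by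
  intro l hl
  have hc : ContinuousAt φ l := hφ.continuousAt (hU.mem_nhds hl)
  -- The slope of `φ` between `k` and `l` is exactly `1 / q (φ k, φ l)`.
  have hqc : ContinuousAt (fun k => (q (φ k, φ l))⁻¹) l :=
    (hq.continuousAt.comp (hc.prodMk continuousAt_const)).inv₀ (hne l hl)
  refine HasDerivAt.differentiableAt (f' := (q (φ l, φ l))⁻¹) ?_ |>.differentiableWithinAt
  rw [hasDerivAt_iff_tendsto_slope]
  refine (hqc.tendsto.mono_left nhdsWithin_le_nhds).congr' ?_
  filter_upwards [nhdsWithin_le_nhds (hU.mem_nhds hl), self_mem_nhdsWithin] with k hk hkl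
  have h1 := hPq (φ k) (φ l)
  rw [hP k hk, hP l hl, add_sub_add_left_eq_sub] at h1
  have h2 : k - l ≠ 0 := sub_ne_zero.2 hkl
  have h3 : q (φ k, φ l) ≠ 0 := fun h => h2 (by rw [h1, h, zero_mul])
  rw [slope_def_field, h1]
  have h4 : φ k - φ l ≠ 0 := fun h => h2 (by rw [h1, h, mul_zero])
  field_simp

/-- If `P'` is not constant, neither is `P' ∘ φ` on a circle, for a solution `φ` of
`P (φ l) = a + l`. -/
theorem exists_derivative_eval_ne {P : Polynomial ℂ} (hn : 2 ≤ P.natDegree) {φ : ℂ → ℂ} {a : ℂ}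
    {r : ℝ} (hr : 0 < r) (hP : ∀ l ∈ sphere (0 : ℂ) r, P.eval (φ l) = a + l) (c : ℂ) :
    ∃ l ∈ sphere (0 : ℂ) r, P.derivative.eval (φ l) ≠ c := by
  by_contra! h
  have hinj : InjOn φ (sphere 0 r) := fun x hx y hy hxy => by
    have h1 := hP x hx
    rw [hxy, hP y hy] at h1
    exact (add_left_cancel h1).symm
  have hinf : (sphere (0 : ℂ) r).Infinite := by
    have h1 : circleMap 0 r '' Ioc 0 (2 * Real.pi) = sphere 0 r := by
      rw [image_circleMap_Ioc, abs_of_pos hr]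
    rw [← h1]
    refine (Ioc_infinite Real.two_pi_pos).image ?_
    rw [← uIoc_of_le Real.two_pi_pos.le]
    exact injOn_circleMap_of_abs_sub_le hr.ne' (by simp [abs_of_pos Real.pi_pos])
  have heq : P.derivative = Polynomial.C c := by
    refine Polynomial.eq_of_infinite_eval_eq _ _ ((hinf.image hinj).mono ?_)
    rintro _ ⟨l, hl, rfl⟩
    simpa using h l hl
  have h2 := Polynomial.natDegree_derivative P
  rw [heq, Polynomial.natDegree_C] at h2
  omega

/-! ### Mean length of the shifted lemniscates -/

/-- Near `z₀`, the map `z ↦ φ (z, l)` expands distances by almost the absolute value of its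
derivative at `z₀`, uniformly in `l` on a circle. -/
theorem exists_open_expansion {P : Polynomial ℂ} {q : ℂ × ℂ → ℂ} (hq : Continuous q)
    (hPq : ∀ x y, P.eval x - P.eval y = q (x, y) * (x - y)) {E : Set ℂ} {r ε : ℝ} (hε : 0 < ε)
    {φ : ℂ × ℂ → ℂ} (hφP : ∀ z ∈ E, ∀ l ∈ sphere (0 : ℂ) r, P.eval (φ (z, l)) = P.eval z + l)
    (hφq : ∀ z ∈ E, ∀ l ∈ sphere (0 : ℂ) r, q (φ (z, l), φ (z, l)) ≠ 0)
    (hφ : ContinuousOn φ (E ×ˢ sphere 0 r)) {z₀ : ℂ} (hz₀ : z₀ ∈ E) :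
    ∃ U, IsOpen U ∧ z₀ ∈ U ∧ ∀ l ∈ sphere (0 : ℂ) r, ∀ x ∈ E ∩ U, ∀ y ∈ E ∩ U,
      (‖q (z₀, z₀) / q (φ (z₀, l), φ (z₀, l))‖ - ε) * dist x y ≤
        dist (φ (x, l)) (φ (y, l)) := by
  have hΦ : Continuous fun p : E × sphere (0 : ℂ) r => φ (p.1, p.2) :=
    hφ.comp_continuous (by fun_prop) fun p => ⟨p.1.2, p.2.2⟩
  have hden : Continuous fun p : (E × E) × sphere (0 : ℂ) r =>
      q (φ (p.1.1, p.2), φ (p.1.2, p.2)) :=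
    hq.comp ((hΦ.comp (by fun_prop : Continuous fun p : (E × E) × sphere (0 : ℂ) r =>
      (p.1.1, p.2))).prodMk (hΦ.comp (by fun_prop : Continuous
        fun p : (E × E) × sphere (0 : ℂ) r => (p.1.2, p.2))))
  have hev : ∀ᶠ p : E × E in 𝓝 (⟨z₀, hz₀⟩, ⟨z₀, hz₀⟩), ∀ l ∈ (univ : Set (sphere (0 : ℂ) r)),
      q (φ (p.1, l), φ (p.2, l)) ≠ 0 ∧ ‖q (z₀, z₀) / q (φ (z₀, l), φ (z₀, l))‖ - ε <
        ‖q (p.1, p.2) / q (φ (p.1, l), φ (p.2, l))‖ := by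
    -- Compactness of the circle gives one neighbourhood valid for all `l`.
    refine isCompact_univ.eventually_forall_of_forall_eventually fun l _ => ?_
    have hne := hφq z₀ hz₀ l l.2
    have h1 : ContinuousAt (fun p : (E × E) × sphere (0 : ℂ) r =>
        ‖q (p.1.1, p.1.2) / q (φ (p.1.1, p.2), φ (p.1.2, p.2))‖)
        ((⟨z₀, hz₀⟩, ⟨z₀, hz₀⟩), l) :=
      (ContinuousAt.div (by fun_prop) hden.continuousAt hne).norm
    have h2 : ContinuousAt (fun p : (E × E) × sphere (0 : ℂ) r =>
        ‖q (z₀, z₀) / q (φ (z₀, p.2), φ (z₀, p.2))‖ - ε) ((⟨z₀, hz₀⟩, ⟨z₀, hz₀⟩), l) := by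
      have h3 : Continuous fun p : (E × E) × sphere (0 : ℂ) r => q (φ (z₀, p.2), φ (z₀, p.2)) :=
        hden.comp (by fun_prop : Continuous fun p : (E × E) × sphere (0 : ℂ) r =>
          (((⟨z₀, hz₀⟩, ⟨z₀, hz₀⟩), p.2) : (E × E) × sphere (0 : ℂ) r))
      exact (ContinuousAt.div (by fun_prop) h3.continuousAt hne).norm.sub continuousAt_const
    exact (hden.continuousAt.eventually_ne hne).and (h2.eventually_lt h1 (by simpa using hε))
  rw [nhds_prod_eq, eventually_prod_self_iff'] at hev
  obtain ⟨t, ht, hts⟩ := hev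
  obtain ⟨V, hV, hVt⟩ := mem_nhds_subtype _ _ _ |>.1 ht
  obtain ⟨U, hUV, hU, hzU⟩ := _root_.mem_nhds_iff.1 hV
  refine ⟨U, hU, hzU, fun l hl x hx y hy => ?_⟩
  obtain ⟨hne, hlt⟩ := hts ⟨x, hx.1⟩ (hVt (hUV hx.2)) ⟨y, hy.1⟩ (hVt (hUV hy.2)) ⟨l, hl⟩ trivial
  dsimp only at hne hlt
  have h1 := hPq (φ (x, l)) (φ (y, l))
  rw [hφP x hx.1 l hl, hφP y hy.1 l hl, add_sub_add_right_eq_sub, hPq] at h1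
  have h2 : φ (x, l) - φ (y, l) = q (x, y) / q (φ (x, l), φ (y, l)) * (x - y) := by
    rw [div_mul_eq_mul_div, h1, mul_div_cancel_left₀ _ hne]
  rw [dist_eq_norm (φ _), h2, norm_mul, ← dist_eq_norm]
  gcongr

/-- On average over small shifts `l`, the continuation `φ (·, l)` strictly increases length. -/
theorem exists_average_length_gt {P : Polynomial ℂ} (hn : 2 ≤ P.natDegree) {q : ℂ × ℂ → ℂ}
    (hq : Continuous q) (hPq : ∀ x y, P.eval x - P.eval y = q (x, y) * (x - y))
    (hqP : ∀ x, q (x, x) = P.derivative.eval x) {E : Set ℂ} (hE : IsCompact E)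
    (hEfin : μH[1] E ≠ ⊤) {δ r : ℝ} (hr : 0 < r) (hrδ : r < δ) {φ : ℂ × ℂ → ℂ}
    (hφP : ∀ z ∈ E, ∀ l ∈ ball (0 : ℂ) δ, P.eval (φ (z, l)) = P.eval z + l)
    (hφq : ∀ z ∈ E, ∀ l ∈ ball (0 : ℂ) δ, q (φ (z, l), φ (z, l)) ≠ 0)
    (hφ0 : ∀ z ∈ E, φ (z, 0) = z) (hφ : ContinuousOn φ (E ×ˢ ball 0 δ))
    (hφi : ∀ l ∈ ball (0 : ℂ) δ, InjOn (fun z => φ (z, l)) E) (hEpos : μH[1] E ≠ 0) :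
    ∃ g : ℂ → ℝ, CircleIntegrable g 0 r ∧ (μH[1] E).toReal < Real.circleAverage g 0 r ∧
      ∀ l ∈ sphere (0 : ℂ) r, ENNReal.ofReal (g l) ≤ μH[1] ((fun z => φ (z, l)) '' E) := by
  have hball : closedBall (0 : ℂ) r ⊆ ball 0 δ := closedBall_subset_ball hrδ
  have hsph : sphere (0 : ℂ) r ⊆ ball 0 δ := sphere_subset_closedBall.trans hball
  have hcl : ∀ l ∈ ball (0 : ℂ) δ, ContinuousOn (fun z => φ (z, l)) E := fun l hl =>
    hφ.comp (by fun_prop) fun z hz => ⟨hz, hl⟩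
  -- The claim ranges over all measurable `A` so that overlapping pieces can be cut apart. The
  -- minorant `g` avoids asking whether the image length is measurable in `l`.
  have key : ∃ S, MeasurableSet S ∧ E ⊆ S ∧ ∀ A ⊆ E ∩ S, MeasurableSet A → ∃ g : ℂ → ℝ,
      CircleIntegrable g 0 r ∧ (μH[1] A).toReal ≤ Real.circleAverage g 0 r ∧
      (μH[1] A ≠ 0 → (μH[1] A).toReal < Real.circleAverage g 0 r) ∧
      ∀ l ∈ sphere (0 : ℂ) r, ENNReal.ofReal (g l) ≤ μH[1] ((fun z => φ (z, l)) '' A) := by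
    refine hE.induction_on (p := fun B => ∃ S, MeasurableSet S ∧ B ⊆ S ∧ ∀ A ⊆ E ∩ S,
      MeasurableSet A → ∃ g : ℂ → ℝ, CircleIntegrable g 0 r ∧
      (μH[1] A).toReal ≤ Real.circleAverage g 0 r ∧
      (μH[1] A ≠ 0 → (μH[1] A).toReal < Real.circleAverage g 0 r) ∧
      ∀ l ∈ sphere (0 : ℂ) r, ENNReal.ofReal (g l) ≤ μH[1] ((fun z => φ (z, l)) '' A))
      ?_ ?_ ?_ ?_
    · refine ⟨∅, .empty, subset_rfl, fun A hA _ => ⟨fun _ => 0, circleIntegrable_const 0 0 r, ?_⟩⟩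
      have hA0 : A = ∅ := subset_empty_iff.1 (by simpa using hA)
      simp [hA0, Real.circleAverage_const]
    · rintro B C hBC ⟨S, hS, hCS, h⟩
      exact ⟨S, hS, hBC.trans hCS, h⟩
    · rintro B C ⟨S, hS, hBS, h⟩ ⟨T, hT, hCT, h'⟩
      refine ⟨S ∪ T, hS.union hT, union_subset_union hBS hCT, fun A hA hAm => ?_⟩
      obtain ⟨g, hgi, hg1, hg2, hg3⟩ := h (A ∩ S) (fun x hx => ⟨(hA hx.1).1, hx.2⟩) (hAm.inter hS)
      obtain ⟨k, hki, hk1, hk2, hk3⟩ := h' (A \ S)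
        (fun x hx => ⟨(hA hx.1).1, (hA hx.1).2.resolve_left hx.2⟩) (hAm.diff hS)
      have hAfin : μH[1] A ≠ ⊤ := measure_ne_top_of_subset (fun x hx => (hA hx).1) hEfin
      have hμ : (μH[1] A).toReal = (μH[1] (A ∩ S)).toReal + (μH[1] (A \ S)).toReal := by
        rw [← ENNReal.toReal_add (measure_ne_top_of_subset inter_subset_left hAfin)
          (measure_ne_top_of_subset sdiff_subset hAfin), measure_inter_add_sdiff A hS]
      have havg := Real.circleAverage_fun_add hgi hki
      refine ⟨fun l => g l + k l, hgi.add hki, ?_, fun hne => ?_, fun l hl => ?_⟩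
      · rw [hμ, havg]
        exact add_le_add hg1 hk1
      · rw [hμ, havg]
        by_cases h0 : μH[1] (A ∩ S) = 0
        · refine add_lt_add_of_le_of_lt hg1 (hk2 fun h1 => hne ?_)
          rw [← measure_inter_add_sdiff A hS, h0, h1, add_zero]
        · exact add_lt_add_of_lt_of_le (hg2 h0) hk1
      · have hAE : A ⊆ E := fun x hx => (hA hx).1
        -- Injectivity of `φ (·, l)` keeps the images disjoint, so their lengths add.
        have hdisj : Disjoint ((fun z => φ (z, l)) '' (A ∩ S)) ((fun z => φ (z, l)) '' (A \ S)) :=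
          (disjoint_sdiff_inter.symm).image (hφi l (hsph hl)) (inter_subset_left.trans hAE)
            (sdiff_subset.trans hAE)
        have hmeas : MeasurableSet ((fun z => φ (z, l)) '' (A \ S)) :=
          (hAm.diff hS).image_of_continuousOn_injOn
            ((hcl l (hsph hl)).mono (sdiff_subset.trans hAE))
            ((hφi l (hsph hl)).mono (sdiff_subset.trans hAE))
        calc ENNReal.ofReal (g l + k l)
            ≤ ENNReal.ofReal (g l) + ENNReal.ofReal (k l) := ENNReal.ofReal_add_le
          _ ≤ _ := add_le_add (hg3 l hl) (hk3 l hl)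
          _ = μH[1] ((fun z => φ (z, l)) '' A) := by
            rw [← measure_union hdisj hmeas, ← image_union, inter_union_sdiff]
    · intro z hz
      have hz1 : ContinuousOn (fun l => φ (z, l)) (ball 0 δ) :=
        hφ.comp (by fun_prop) fun l hl => ⟨hz, hl⟩
      have hz2 : DifferentiableOn ℂ (fun l => φ (z, l)) (ball 0 δ) :=
        differentiableOn_of_eval_eq hq hPq isOpen_ball hz1 (hφP z hz) (hφq z hz)
      have hd : DifferentiableOn ℂ (fun l => q (z, z) / q (φ (z, l), φ (z, l))) (ball 0 δ) := by
        refine DifferentiableOn.div (differentiableOn_const _) ?_ (hφq z hz)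
        simp only [hqP]
        exact P.derivative.differentiable.comp_differentiableOn hz2
      have hgt : 1 < Real.circleAverage (fun l => ‖q (z, z) / q (φ (z, l), φ (z, l))‖) 0 r := by
        by_contra! hle
        have hqz : q (z, z) ≠ 0 := by
          have := hφq z hz 0 (mem_ball_self (hr.trans hrδ))
          rwa [hφ0 z hz] at this
        have h1 := eq_one_of_circleAverage_norm_le hr (hd.diffContOnCl_ball hball)
          (by simp [hφ0 z hz, hqz]) hle
        obtain ⟨l, hl, hne⟩ := exists_derivative_eval_ne hn hr
          (fun l hl => hφP z hz l (hsph hl)) (q (z, z))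
        refine hne ?_
        have h2 := h1 l hl
        rw [div_eq_one_iff_eq (hφq z hz l (hsph hl)), hqP (φ _)] at h2
        exact h2.symm
      set M := Real.circleAverage (fun l => ‖q (z, z) / q (φ (z, l), φ (z, l))‖) 0 r with hM
      -- The loss `(M - 1) / 2` leaves a mean factor `(M + 1) / 2 > 1`.
      obtain ⟨U, hU, hzU, hUe⟩ := exists_open_expansion hq hPq (half_pos (sub_pos.2 hgt))
        (fun z hz l hl => hφP z hz l (hsph hl)) (fun z hz l hl => hφq z hz l (hsph hl))
        (hφ.mono (prod_mono_right hsph)) hz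
      refine ⟨U, mem_nhdsWithin_of_mem_nhds (hU.mem_nhds hzU), U, hU.measurableSet, subset_rfl,
        fun A hA _ => ?_⟩
      have hAfin : μH[1] A ≠ ⊤ := measure_ne_top_of_subset (fun x hx => (hA hx).1) hEfin
      have hint : CircleIntegrable (fun l => ‖q (z, z) / q (φ (z, l), φ (z, l))‖) 0 r :=
        (hd.continuousOn.mono hsph).norm.circleIntegrable hr.le
      have hint' := hint.sub (circleIntegrable_const ((M - 1) / 2) 0 r)
      have havg : Real.circleAverage (fun l => (μH[1] A).toReal •
          (‖q (z, z) / q (φ (z, l), φ (z, l))‖ - (M - 1) / 2)) 0 r =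
          (μH[1] A).toReal * ((M + 1) / 2) := by
        rw [Real.circleAverage_fun_smul, Real.circleAverage_fun_sub hint
          (circleIntegrable_const _ 0 r), Real.circleAverage_const, ← hM, smul_eq_mul]
        ring
      refine ⟨_, hint'.const_smul (a := (μH[1] A).toReal), ?_, fun hne => ?_, fun l hl => ?_⟩
      · refine le_of_le_of_eq ?_ havg.symm
        exact le_mul_of_one_le_right ENNReal.toReal_nonneg (by linarith)
      · refine lt_of_lt_of_eq ?_ havg.symm
        exact lt_mul_of_one_lt_right (ENNReal.toReal_pos hne hAfin) (by linarith)
      · refine le_trans (le_of_eq ?_) (ofReal_mul_hausdorffMeasure_le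
          (F := fun z => φ (z, l)) fun x hx y hy => hUe l hl x (hA hx) y (hA hy))
        simp only [Pi.smul_apply, Pi.sub_apply, smul_eq_mul]
        rw [ENNReal.ofReal_mul ENNReal.toReal_nonneg, ENNReal.ofReal_toReal hAfin, mul_comm]
  obtain ⟨S, _, hES, h⟩ := key
  obtain ⟨g, hgi, -, hg2, hg3⟩ := h E (subset_inter subset_rfl hES) hE.measurableSet
  exact ⟨g, hgi, hg2 hEpos, hg3⟩

/-! ### The length of the level curve is finite and positive -/

/-- A level curve of a polynomial without critical points has finite length. -/
theorem hausdorffMeasure_levelSet_lt_top {P : Polynomial ℂ} {q : ℂ × ℂ → ℂ} (hq : Continuous q)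
    (hPq : ∀ x y, P.eval x - P.eval y = q (x, y) * (x - y)) {E : Set ℂ} (hE : IsCompact E)
    (hEq : ∀ z ∈ E, q (z, z) ≠ 0) (hEP : ∀ z ∈ E, ‖P.eval z‖ = 1) : μH[1] E < ⊤ := by
  refine hE.measure_lt_top_of_nhdsWithin fun z hz => ?_
  have hpos := norm_pos_iff.2 (hEq z hz)
  have hev : ∀ᶠ p : ℂ × ℂ in 𝓝 (z, z), ‖q (z, z)‖ / 2 < ‖q p‖ :=
    continuousAt_const.eventually_lt hq.norm.continuousAt (half_lt_self hpos)
  rw [nhds_prod_eq, eventually_prod_self_iff'] at hev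
  obtain ⟨t, ht, hts⟩ := hev
  refine ⟨E ∩ t, inter_mem self_mem_nhdsWithin (nhdsWithin_le_nhds ht), ?_⟩
  -- Locally `P` itself expands `E` into the unit circle, whose length is finite.
  have h1 := ofReal_mul_hausdorffMeasure_le (F := fun z => P.eval z) (s := E ∩ t)
    (c := ‖q (z, z)‖ / 2) fun x hx y hy => by
      rw [dist_eq_norm (P.eval x), hPq, norm_mul, ← dist_eq_norm]
      have := hts x hx.2 y hy.2
      gcongr
  have h2 : (fun z => P.eval z) '' (E ∩ t) ⊆ sphere 0 1 := by
    rintro _ ⟨x, hx, rfl⟩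
    simpa using hEP x hx.1
  have h3 := (h1.trans (measure_mono h2)).trans_lt hausdorffMeasure_sphere_lt_top
  exact ENNReal.lt_top_of_mul_ne_top_right h3.ne (by simpa using hEq z hz)

/-- The level curve `|P| = 1` of a nonconstant polynomial has positive length. -/
theorem hausdorffMeasure_levelSet_ne_zero {P : Polynomial ℂ} (hn : P.natDegree ≠ 0)
    {q : ℂ × ℂ → ℂ} (hq : Continuous q)
    (hPq : ∀ x y, P.eval x - P.eval y = q (x, y) * (x - y))
    (hE : IsCompact {z | ‖P.eval z‖ = 1}) : μH[1] {z | ‖P.eval z‖ = 1} ≠ 0 := by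
  intro h0
  obtain ⟨C, hC⟩ := (hE.prod hE).exists_bound_of_continuousOn hq.continuousOn
  have hlip : LipschitzOnWith (Real.toNNReal C) (fun z => P.eval z) {z | ‖P.eval z‖ = 1} :=
    LipschitzOnWith.of_dist_le_mul fun x hx y hy => by
      rw [dist_eq_norm (P.eval x), hPq, norm_mul, ← dist_eq_norm]
      gcongr
      exact (hC (x, y) ⟨hx, hy⟩).trans (Real.le_coe_toNNReal C)
  have h1 := hlip.hausdorffMeasure_image_le (zero_le_one' ℝ)
  rw [h0, mul_zero] at h1
  -- `P` is Lipschitz on `E` and covers the circle, so `E` cannot be null.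
  have h2 : sphere (0 : ℂ) 1 ⊆ (fun z => P.eval z) '' {z | ‖P.eval z‖ = 1} := by
    intro w hw
    obtain ⟨z, hz⟩ := IsAlgClosed.exists_root (P - Polynomial.C w) (by
      rw [Polynomial.degree_sub_C (Polynomial.natDegree_pos_iff_degree_pos.1
        (Nat.pos_of_ne_zero hn))]
      exact (Polynomial.natDegree_pos_iff_degree_pos.1 (Nat.pos_of_ne_zero hn)).ne')
    have hz' : P.eval z = w := by simpa [sub_eq_zero] using hz
    exact ⟨z, by simpa [hz'] using hw, hz'⟩
  exact absurd ((measure_mono h2).trans h1) (not_le.2 hausdorffMeasure_sphere_pos)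

theorem isCompact_levelSet {P : Polynomial ℂ} (hn : P.natDegree ≠ 0) :
    IsCompact {z | ‖P.eval z‖ = 1} := by
  refine isCompact_of_isClosed_isBounded
    (isClosed_eq P.continuous.norm continuous_const) ?_
  have h := P.tendsto_norm_atTop (Polynomial.natDegree_pos_iff_degree_pos.1
    (Nat.pos_of_ne_zero hn)) (tendsto_norm_cocompact_atTop (E := ℂ))
  have h1 := h.eventually_gt_atTop 1
  rw [← cobounded_eq_cocompact] at h1
  rw [← Bornology.isCobounded_compl_iff]
  filter_upwards [h1] with z hz
  exact hz.ne'

theorem lemniscate_zero (f : ℂ → ℂ) : lemniscate f 0 = {z | ‖f z‖ = 1} := by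
  ext z
  simp only [lemniscate, mem_ofPred_eq]
  constructor
  · rintro ⟨h1, h2⟩
    exact Real.eq_one_of_pos_of_log_eq_zero (norm_pos_iff.2 h1) h2
  · intro h
    exact ⟨norm_pos_iff.1 (h ▸ one_pos), by rw [h, Real.log_one]⟩

end Lemniscate

/-! ### Contradiction with extremality -/

theorem mainTheorem8 (n : ℕ) (hn : 2 ≤ n) (P : Polynomial ℂ) (hP : IsExtremalPolynomial n P) :
    ({z : ℂ | P.derivative.eval z = 0} ∩ lemniscate (fun z => P.eval z) 0).Nonempty := by
  obtain ⟨hmon, rfl, hmax⟩ := hP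
  by_contra hempty
  have hn0 : P.natDegree ≠ 0 := by omega
  obtain ⟨q, hq, hPq, hqP⟩ := Lemniscate.exists_dividedDifference P
  have hE := Lemniscate.isCompact_levelSet hn0
  have hEq : ∀ z ∈ {z | ‖P.eval z‖ = 1}, q (z, z) ≠ 0 := fun z hz h0 =>
    hempty ⟨z, by rwa [hqP] at h0, by rwa [Lemniscate.lemniscate_zero]⟩
  have hfin := (Lemniscate.hausdorffMeasure_levelSet_lt_top hq hPq hE hEq fun _ hz => hz).ne
  have hpos := Lemniscate.hausdorffMeasure_levelSet_ne_zero hn0 hq hPq hE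
  obtain ⟨δ, hδ, φ, hφP, hφq, hφ0, hφ, hφi⟩ :=
    Lemniscate.exists_continuation hmon hn0 hq hPq hE hEq
  have hr : 0 < δ / 2 := half_pos hδ
  obtain ⟨g, hgi, hg, hgl⟩ := Lemniscate.exists_average_length_gt hn hq hPq hqP hE hfin hr
    (half_lt_self hδ) hφP hφq hφ0 hφ hφi hpos
  -- Extremality bounds `g` by `|E|` at every point of the circle, hence also its mean.
  refine absurd hg (not_lt.2 (Real.circleAverage_mono_on_of_le_circle hgi fun l hl => ?_))
  rw [abs_of_pos hr] at hl
  have hl' : l ∈ ball (0 : ℂ) δ := by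
    rw [mem_sphere] at hl
    rw [mem_ball, hl]
    exact half_lt_self hδ
  have hdeg : 0 < P.degree := Polynomial.natDegree_pos_iff_degree_pos.1 (Nat.pos_of_ne_zero hn0)
  have hle := hmax (P - Polynomial.C l)
    (hmon.sub_of_left (Polynomial.degree_C_le.trans_lt hdeg)) Polynomial.natDegree_sub_C
  simp only [lemniscateLength, Lemniscate.lemniscate_zero] at hle
  have hsub : (fun z => φ (z, l)) '' {z | ‖P.eval z‖ = 1} ⊆
      {z | ‖(P - Polynomial.C l).eval z‖ = 1} := by
    rintro _ ⟨z, hz, rfl⟩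
    simpa [hφP z hz l hl'] using hz
  exact (ENNReal.ofReal_le_iff_le_toReal hfin).1
    (((hgl l hl).trans (measure_mono hsub)).trans hle)
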